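/- Let $(R,\mathfrak m)$ be a complete discrete valuation ring with finite residue field $R/\mathfrak m=\mathbb F_q$, and let $H$ be any $R$-module of finite length. For $n\ge 0$ equip the compact group $\mathrm{Mat}_n(R)$ of $n\times n$ matrices with the Haar probability measure for its additive structure (with respect to the $\mathfrak m$-adic topology), and let $A$ be a random element of $\mathrm{GL}_n(R)$ distributed according to the restriction of this measure to $\mathrm{GL}_n(R)$, normalized to have total mass $1$. Let $I_n$ be the identity matrix and $\mathrm{coker}(A-I_n)=R^n/(A-I_n)R^n$. Then the infinite product $\prod_{i=1}^{\infty}(1-q^{-i})$ converges and $$\lim_{n\to\infty}\mathrm{Prob}_{A\in \mathrm{GL}_n(R)}\bigl(\mathrm{coker}(A-I_n)\simeq H\bigr)=\frac{1}{|\mathrm{Aut}_R(H)|}\prod_{i=1}^{\infty}\bigl(1-q^{-i}\bigr),$$ where $\simeq$ denotes isomorphism of $R$-modules and $\mathrm{Aut}_R(H)$ is the (finite) group of $R$-linear automorphisms of $H$. -/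

import Mathlib

open MeasureTheory Filter Topology

namespace HaarCokernel

universe u

/-- If `I` is finitely generated, `R` is `I`-adically (pre)complete and `R ⧸ I` is finite, then `R`
is compact in its `I`-adic topology. -/
theorem compactSpace_adicTopology {R : Type u} [CommRing R] (I : Ideal R) (hI : I.FG)
    [IsPrecomplete I R] [Finite (R ⧸ I)] : @CompactSpace R I.adicTopology := by
  letI := I.adicTopology
  have hfin : ∀ n : ℕ, Finite (R ⧸ I ^ n) := fun n => Ideal.finite_quotient_pow hI n
  refine ⟨isCompact_iff_ultrafilter_le_nhds.2 fun f _ => ?_⟩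
  have key : ∀ n : ℕ, ∃ a : R, {x : R | x - a ∈ I ^ n} ∈ f := by
    intro n
    obtain ⟨b, hb⟩ := Ultrafilter.eq_pure_of_finite (f.map (Ideal.Quotient.mk (I ^ n)))
    obtain ⟨a, rfl⟩ := Ideal.Quotient.mk_surjective b
    refine ⟨a, ?_⟩
    have h1 : ({Ideal.Quotient.mk (I ^ n) a} : Set (R ⧸ I ^ n)) ∈
        f.map (Ideal.Quotient.mk (I ^ n)) := by
      rw [hb]; exact Set.mem_singleton _
    rw [Ultrafilter.mem_map] at h1
    filter_upwards [h1] with x hx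
    exact Ideal.Quotient.eq.1 hx
  choose a ha using key
  have hcauchy : ∀ {m n : ℕ}, m ≤ n → a m ≡ a n [SMOD (I ^ m • ⊤ : Submodule R R)] := by
    intro m n hmn
    obtain ⟨x, hxm, hxn⟩ := f.nonempty_of_mem (Filter.inter_mem (ha m) (ha n))
    rw [SModEq.sub_mem, smul_eq_mul, Ideal.mul_top]
    have h2 : x - a n ∈ I ^ m := Ideal.pow_le_pow_right hmn hxn
    have h3 := (I ^ m).sub_mem h2 hxm
    have e : x - a n - (x - a m) = a m - a n := by ring
    rwa [e] at h3
  obtain ⟨L, hL⟩ := IsPrecomplete.prec (I := I) (M := R) inferInstance hcauchy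
  refine ⟨L, Set.mem_univ _, ?_⟩
  rw [(I.hasBasis_nhds_adic L).ge_iff]
  intro n _
  have hLn := hL n
  rw [SModEq.sub_mem, smul_eq_mul, Ideal.mul_top] at hLn
  refine Filter.mem_of_superset (ha n) fun x hx => ⟨x - L, ?_, by ring⟩
  have h4 := (I ^ n).add_mem hx hLn
  have e : x - a n + (a n - L) = x - L := by ring
  rwa [e] at h4

/-- The product topology on `Mat_n(R)`, where the local ring `R` carries its `𝔪`-adic topology. -/
@[reducible] def matTopology (R : Type u) [CommRing R] [IsLocalRing R] (n : ℕ) :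
    TopologicalSpace (Matrix (Fin n) (Fin n) R) :=
  letI : TopologicalSpace R := (IsLocalRing.maximalIdeal R).adicTopology
  inferInstance

/-- The Borel `σ`-algebra of `Mat_n(R)`. -/
@[reducible] def matBorel (R : Type u) [CommRing R] [IsLocalRing R] (n : ℕ) :
    MeasurableSpace (Matrix (Fin n) (Fin n) R) :=
  @borel _ (matTopology R n)

attribute [local instance] matTopology matBorel

section

variable (R : Type u) [CommRing R]

theorem mat_borelSpace [IsLocalRing R] (n : ℕ) : BorelSpace (Matrix (Fin n) (Fin n) R) := ⟨rfl⟩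

theorem mat_isTopologicalAddGroup [IsLocalRing R] (n : ℕ) :
    IsTopologicalAddGroup (Matrix (Fin n) (Fin n) R) := by
  letI : TopologicalSpace R := (IsLocalRing.maximalIdeal R).adicTopology
  haveI : IsTopologicalRing R :=
    (IsLocalRing.maximalIdeal R).adic_basis.toRing_subgroups_basis.toRingFilterBasis.isTopologicalRing
  exact inferInstanceAs (IsTopologicalAddGroup (Fin n → Fin n → R))

variable [IsDomain R] [IsDiscreteValuationRing R]
  [IsAdicComplete (IsLocalRing.maximalIdeal R) R] [Finite (IsLocalRing.ResidueField R)]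

theorem mat_compactSpace (n : ℕ) : CompactSpace (Matrix (Fin n) (Fin n) R) := by
  letI : TopologicalSpace R := (IsLocalRing.maximalIdeal R).adicTopology
  haveI : Finite (R ⧸ IsLocalRing.maximalIdeal R) :=
    inferInstanceAs (Finite (IsLocalRing.ResidueField R))
  haveI : CompactSpace R :=
    compactSpace_adicTopology (IsLocalRing.maximalIdeal R) (IsNoetherian.noetherian _)
  exact inferInstanceAs (CompactSpace (Fin n → Fin n → R))

/-- The Haar measure of total mass `1` on the compact additive group `Mat_n(R)`, for a complete
discrete valuation ring `R` with finite residue field. -/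
noncomputable def matHaar (n : ℕ) : Measure (Matrix (Fin n) (Fin n) R) :=
  haveI := mat_borelSpace R n
  haveI := mat_isTopologicalAddGroup R n
  haveI := mat_compactSpace R n
  Measure.addHaarMeasure ⊤

/-- The probability measure of a Haar-random `A ∈ GL_n(R)`: the Haar measure on `Mat_n(R)`
restricted to the set of invertible matrices and normalized to total mass `1`. -/
noncomputable def glHaar (n : ℕ) : Measure (Matrix (Fin n) (Fin n) R) :=
  ProbabilityTheory.cond (matHaar R n) {A | IsUnit A}

/-- The probability that a Haar-random `A ∈ GL_n(R)` has the property `E`. -/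
noncomputable def probGL (n : ℕ) (E : Matrix (Fin n) (Fin n) R → Prop) : ℝ :=
  (glHaar R n).real {A | E A}

end

/-- The cokernel `R^n / M R^n` of an `n × n` matrix acting on column vectors. -/
abbrev Coker {R : Type u} [CommRing R] {n : ℕ} (M : Matrix (Fin n) (Fin n) R) : Type u :=
  (Fin n → R) ⧸ LinearMap.range M.mulVecLin

end HaarCokernel

/-! The proof counts presentations. If `A - 1` has cokernel isomorphic to `H`, exactly `|Aut H|`
surjections `F : R^n → H` have kernel equal to the image of `A - 1`; if not, none do. Integrating
over `GL_n(R)`, `|Aut H|` times the measure of the event is the sum over `F` of the measures of `{A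
∈ GL_n(R) : im (A - 1) = ker F}`.

Fix `F`. Since `H` is torsion, `ker F` is free of rank `n`, hence the image of an injective matrix
`D`. The condition then says `A = 1 + D Y` with `Y` and `1 + D Y` invertible, and both can be tested
modulo the maximal ideal. The matrices `D Y` have density `|H|^(-n)`, so it remains to count the `y
∈ GL_n(𝔽_q)` with `1 + D̄ y` invertible, `D̄` being the reduction of `D`. With `g = y⁻¹` these are
the `g` with `g + D̄` injective.

Möbius inversion over subspaces of `ker (g + D̄)`, written with independent tuples, expresses that
count as `|GL_n(𝔽_q)|` times `∑ (-1)^k / ∏_{i≤k} (q^i - 1)` weighted by `indepRatio`. It depends on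
`D̄` only through `|ker D̄| = |H / 𝔪H|`, so every `F` contributes equally. The factor `|GL_n(𝔽_q)|`
cancels against the measure of `GL_n(R)`, which gives the exact formula `probGL_eq`.

As `n → ∞`, almost all of the `|H|^n` homomorphisms are surjective and every weight tends to `1`. By
dominated convergence the sum tends to Euler's series, whose value is `∏ (1 - q^{-i})`. -/

namespace HaarCokernel

/-! ### `q`-series: alternating sums and Euler's identity -/

/-- The product `∏_{i=1}^{k} (q^i - 1)`. -/
noncomputable def qFactorial (q : ℝ) (k : ℕ) : ℝ := ∏ i ∈ Finset.range k, (q ^ (i + 1) - 1)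

theorem qFactorial_succ (q : ℝ) (k : ℕ) :
    qFactorial q (k + 1) = qFactorial q k * (q ^ (k + 1) - 1) := Finset.prod_range_succ _ _

theorem qFactorial_pos {q : ℝ} (hq : 1 < q) (k : ℕ) : 0 < qFactorial q k :=
  Finset.prod_pos fun i _ => sub_pos.2 (one_lt_pow₀ hq i.succ_ne_zero)

/-- Truncated `q`-binomial sums telescope. -/
theorem sum_qBinomial_telescope {q : ℝ} (hq : 1 < q) (N : ℝ) (K : ℕ) :
    ∑ k ∈ Finset.range (K + 1),
        (-1) ^ k / qFactorial q k * ∏ i ∈ Finset.range k, (N - q ^ i) =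
      (-1) ^ K / qFactorial q K * ∏ i ∈ Finset.range K, (N - q ^ (i + 1)) := by
  induction K with
  | zero => simp
  | succ K ih =>
    rw [Finset.sum_range_succ, ih, qFactorial_succ, Finset.prod_range_succ',
      Finset.prod_range_succ]
    have h1 := (qFactorial_pos hq K).ne'
    have h2 : q ^ (K + 1) - 1 ≠ 0 := (sub_pos.2 (one_lt_pow₀ hq K.succ_ne_zero)).ne'
    field_simp
    ring

/-- For a `q^d`-element vector space, inclusion-exclusion over independent tuples detects
whether `d = 0`. -/
theorem sum_qBinomial_pow {q : ℝ} (hq : 1 < q) {d n : ℕ} (hd : d ≤ n) :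
    ∑ k ∈ Finset.range (n + 1),
        (-1) ^ k / qFactorial q k * ∏ i ∈ Finset.range k, (q ^ d - q ^ i) =
      if d = 0 then 1 else 0 := by
  rw [sum_qBinomial_telescope hq]
  split_ifs with h
  · subst h
    have : ∏ i ∈ Finset.range n, (q ^ 0 - q ^ (i + 1)) = (-1) ^ n * qFactorial q n := by
      rw [qFactorial, ← Finset.card_range n, ← Finset.prod_const, Finset.card_range,
        ← Finset.prod_mul_distrib]
      exact Finset.prod_congr rfl fun i _ => by ring
    rw [this]
    have h1 := (qFactorial_pos hq n).ne'
    field_simp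
    rw [← pow_mul, mul_comm, pow_mul]
    simp
  -- For `1 ≤ d ≤ n` the factor with index `d - 1` in the telescoped product is zero.
  · obtain ⟨e, rfl⟩ := Nat.exists_eq_succ_of_ne_zero h
    rw [Finset.prod_eq_zero (Finset.mem_range.2 (Nat.lt_of_succ_le hd)) (sub_self _), mul_zero]

theorem summable_inv_qFactorial {q : ℝ} (hq : 1 < q) :
    Summable fun k => (qFactorial q k)⁻¹ := by
  refine summable_of_ratio_test_tendsto_lt_one (l := 0) zero_lt_one
    (Eventually.of_forall fun k => (inv_pos.2 (qFactorial_pos hq k)).ne') ?_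
  have : (fun k => ‖(qFactorial q (k + 1))⁻¹‖ / ‖(qFactorial q k)⁻¹‖) =
      fun k => (q ^ (k + 1) - 1)⁻¹ := by
    funext k
    have h1 := qFactorial_pos hq k
    have h2 := qFactorial_pos hq (k + 1)
    rw [Real.norm_of_nonneg (inv_pos.2 h1).le, Real.norm_of_nonneg (inv_pos.2 h2).le,
      qFactorial_succ]
    field_simp
  rw [this]
  refine Tendsto.inv_tendsto_atTop (tendsto_atTop_add_const_right _ _ ?_)
  exact (tendsto_pow_atTop_atTop_of_one_lt hq).comp (tendsto_add_atTop_nat 1)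

/-- Euler's `q`-exponential series `∑ (-z)^k / ∏_{i=1}^k (q^i - 1)`. -/
noncomputable def qExp (q z : ℝ) : ℝ := ∑' k : ℕ, (-z) ^ k / qFactorial q k

theorem norm_qExp_term_le {q z : ℝ} (hq : 1 < q) (hz : |z| ≤ 1) (k : ℕ) :
    ‖(-z) ^ k / qFactorial q k‖ ≤ (qFactorial q k)⁻¹ := by
  have h1 := qFactorial_pos hq k
  rw [norm_div, norm_pow, norm_neg, Real.norm_of_nonneg h1.le, div_eq_mul_inv]
  exact mul_le_of_le_one_left (inv_pos.2 h1).le (pow_le_one₀ (abs_nonneg z) hz)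

theorem summable_qExp {q z : ℝ} (hq : 1 < q) (hz : |z| ≤ 1) :
    Summable fun k : ℕ => (-z) ^ k / qFactorial q k :=
  (summable_inv_qFactorial hq).of_norm_bounded (norm_qExp_term_le hq hz)

/-- Subtracting the two series produces `q^(k+1) - 1` in the term of degree `k + 1`. This cancels
the last factor of `qFactorial q (k + 1)`, leaving `-z` times the original series. -/
theorem qExp_mul {q z : ℝ} (hq : 1 < q) (hz : |q * z| ≤ 1) :
    qExp q (q * z) = (1 - z) * qExp q z := by
  have hz' : |z| ≤ 1 := by
    rw [abs_mul, abs_of_pos (by linarith)] at hz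
    nlinarith [abs_nonneg z]
  have hs := summable_qExp hq hz
  have hs' := summable_qExp hq hz'
  have key : qExp q (q * z) - qExp q z = -z * qExp q z := by
    rw [qExp, qExp, ← hs.tsum_sub hs', (hs.sub hs').tsum_eq_zero_add, ← tsum_mul_left]
    simp only [pow_zero, sub_self, zero_add]
    refine tsum_congr fun k => ?_
    have h1 := (qFactorial_pos hq k).ne'
    have h2 : q ^ (k + 1) - 1 ≠ 0 := (sub_pos.2 (one_lt_pow₀ hq k.succ_ne_zero)).ne'
    rw [qFactorial_succ, show -(q * z) = q * (-z) by ring, mul_pow]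
    field_simp
    ring
  linarith

theorem qExp_one_eq {q : ℝ} (hq : 1 < q) (J : ℕ) :
    qExp q 1 = (∏ i ∈ Finset.range J, (1 - (q ^ (i + 1))⁻¹)) * qExp q (q ^ J)⁻¹ := by
  have hq0 : 0 < q := by linarith
  induction J with
  | zero => simp
  | succ J ih =>
    have h : q * (q ^ (J + 1))⁻¹ = (q ^ J)⁻¹ := by field_simp; ring
    rw [Finset.prod_range_succ, mul_assoc, ← qExp_mul hq, h, ih]
    rw [h, abs_of_pos (by positivity)]
    exact inv_le_one_of_one_le₀ (one_le_pow₀ hq.le)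

theorem tendsto_qExp_inv_pow {q : ℝ} (hq : 1 < q) :
    Tendsto (fun J : ℕ => qExp q (q ^ J)⁻¹) atTop (𝓝 1) := by
  have hq0 : 0 < q := by linarith
  have h1 : ∑' k : ℕ, (-(0 : ℝ)) ^ k / qFactorial q k = 1 := by
    rw [tsum_eq_single 0 (fun k hk => by simp [hk])]
    simp [qFactorial]
  rw [← h1]
  refine tendsto_tsum_of_dominated_convergence (summable_inv_qFactorial hq) (fun k => ?_)
    (Eventually.of_forall fun J k => norm_qExp_term_le hq ?_ k)
  · exact (((tendsto_pow_atTop_atTop_of_one_lt hq).inv_tendsto_atTop.neg).pow k).div_const _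
  · rw [abs_of_pos (by positivity)]
    exact inv_le_one_of_one_le₀ (one_le_pow₀ hq.le)

theorem multipliable_one_sub_inv_pow {q : ℝ} (hq : 1 < q) :
    Multipliable fun i : ℕ => 1 - (q ^ (i + 1))⁻¹ := by
  have h : Summable fun i : ℕ => (q⁻¹) ^ (i + 1) :=
    (summable_nat_add_iff 1).2 (summable_geometric_of_lt_one (by positivity)
      (inv_lt_one_of_one_lt₀ hq))
  have := multipliable_one_add_of_summable (f := fun i : ℕ => -(q⁻¹) ^ (i + 1))
    (by simpa using h.abs)
  simpa [sub_eq_add_neg] using this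

/-- Euler's identity `∑ (-1)^k / ∏_{i=1}^k (q^i - 1) = ∏ (1 - q^{-i})`. -/
theorem qExp_one {q : ℝ} (hq : 1 < q) : qExp q 1 = ∏' i : ℕ, (1 - (q ^ (i + 1))⁻¹) := by
  have h1 := ((multipliable_one_sub_inv_pow hq).hasProd.tendsto_prod_nat).mul
    (tendsto_qExp_inv_pow hq)
  rw [mul_one] at h1
  refine tendsto_nhds_unique ?_ h1
  simp_rw [← qExp_one_eq hq]
  exact tendsto_const_nhds

/-! ### Limit of the weighted alternating sum -/

/-- The proportion of independent `k`-tuples in a `q^n`-element space that stay independent in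
a quotient by an `h`-element subspace. -/
noncomputable def indepRatio (q h n k : ℕ) : ℝ :=
  ∏ i ∈ Finset.range k, ((q ^ n - h * q ^ i : ℕ) : ℝ) / ((q ^ n - q ^ i : ℕ) : ℝ)

theorem indepRatio_nonneg (q h n k : ℕ) : 0 ≤ indepRatio q h n k :=
  Finset.prod_nonneg fun _ _ => by positivity

theorem indepRatio_le_one {h : ℕ} (q : ℕ) (hh : 1 ≤ h) (n k : ℕ) : indepRatio q h n k ≤ 1 := by
  refine Finset.prod_le_one (fun _ _ => by positivity) fun i _ => ?_
  refine div_le_one_of_le₀ ?_ (Nat.cast_nonneg _)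
  exact_mod_cast Nat.sub_le_sub_left (Nat.le_mul_of_pos_left _ hh) _

theorem tendsto_natCast_pow_sub_div {q : ℕ} (hq : 1 < q) (c : ℕ) :
    Tendsto (fun n : ℕ => ((q ^ n - c : ℕ) : ℝ) / (q : ℝ) ^ n) atTop (𝓝 1) := by
  have hq' : (1 : ℝ) < q := by exact_mod_cast hq
  have h1 : Tendsto (fun n : ℕ => 1 - (c : ℝ) * ((q : ℝ) ^ n)⁻¹) atTop (𝓝 (1 - c * 0)) :=
    ((tendsto_pow_atTop_atTop_of_one_lt hq').inv_tendsto_atTop.const_mul _).const_sub _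
  rw [mul_zero, sub_zero] at h1
  refine h1.congr' ?_
  filter_upwards [(tendsto_pow_atTop_atTop_of_one_lt hq).eventually_ge_atTop c] with n hn
  have : (q : ℝ) ^ n ≠ 0 := by positivity
  rw [Nat.cast_sub hn]
  push_cast
  field_simp

theorem tendsto_indepRatio {q : ℕ} (hq : 1 < q) (h k : ℕ) :
    Tendsto (fun n => indepRatio q h n k) atTop (𝓝 1) := by
  have : Tendsto (fun n => indepRatio q h n k) atTop
      (𝓝 (∏ _i ∈ Finset.range k, (1 / 1 : ℝ))) := by
    refine tendsto_finsetProd _ fun i _ => ?_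
    refine ((tendsto_natCast_pow_sub_div hq (h * q ^ i)).div
      (tendsto_natCast_pow_sub_div hq (q ^ i)) one_ne_zero).congr fun n => ?_
    exact div_div_div_cancel_right₀ (by positivity) _ _
  simpa using this

/-- The weights lie in `[0, 1]` and tend to `1` for fixed `k`, so `1 / qFactorial q k` dominates and
the limit is `qExp q 1`. The dependence on `h` disappears. -/
theorem tendsto_sum_indepRatio {q h : ℕ} (hq : 1 < q) (hh : 1 ≤ h) :
    Tendsto (fun n => ∑ k ∈ Finset.range (n + 1),
        (-1) ^ k / qFactorial q k * indepRatio q h n k) atTop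
      (𝓝 (∏' i : ℕ, (1 - ((q : ℝ) ^ (i + 1))⁻¹))) := by
  have hq' : (1 : ℝ) < q := by exact_mod_cast hq
  rw [← qExp_one hq', qExp]
  have h1 : ∀ n, ∑ k ∈ Finset.range (n + 1), (-1) ^ k / qFactorial q k * indepRatio q h n k =
      ∑' k, if k < n + 1 then (-1) ^ k / qFactorial q k * indepRatio q h n k else 0 := by
    intro n
    rw [tsum_eq_sum (s := Finset.range (n + 1))
      (fun k hk => if_neg (by simpa using hk))]
    exact Finset.sum_congr rfl fun k hk => (if_pos (Finset.mem_range.1 hk)).symm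
  simp_rw [h1]
  refine tendsto_tsum_of_dominated_convergence (summable_inv_qFactorial hq') (fun k => ?_)
    (Eventually.of_forall fun n k => ?_)
  · have := (tendsto_indepRatio hq h k).const_mul ((-1) ^ k / qFactorial (q : ℝ) k)
    rw [mul_one] at this
    refine this.congr' ?_
    filter_upwards [eventually_ge_atTop k] with n hn
    rw [if_pos (Nat.lt_succ_of_le hn)]
  · have h2 := norm_qExp_term_le hq' (z := 1) (by simp) k
    split_ifs
    · rw [norm_mul, Real.norm_of_nonneg (indepRatio_nonneg _ _ _ _)]
      exact (mul_le_of_le_one_right (norm_nonneg _) (indepRatio_le_one q hh n k)).trans h2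
    · rw [norm_zero]
      exact (inv_pos.2 (qFactorial_pos hq' k)).le

/-! ### Counting over a finite field -/

section FiniteField

variable {K V : Type*} [Field K] [AddCommGroup V] [Module K V]

theorem card_linearIndependent_eq_prod [Finite K] [Finite V] (k : ℕ) :
    Nat.card {s : Fin k → V // LinearIndependent K s} =
      ∏ i ∈ Finset.range k, (Nat.card K ^ Module.finrank K V - Nat.card K ^ i) := by
  classical
  have := Fintype.ofFinite K
  have : FiniteDimensional K V := Module.Finite.of_finite
  by_cases hk : k ≤ Module.finrank K V
  · rw [card_linearIndependent hk, Finset.prod_range, Nat.card_eq_fintype_card]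
  · push Not at hk
    have h0 : ∏ i ∈ Finset.range k, (Nat.card K ^ Module.finrank K V - Nat.card K ^ i) = 0 :=
      Finset.prod_eq_zero (Finset.mem_range.2 hk) (Nat.sub_self _)
    rw [h0]
    have : IsEmpty {s : Fin k → V // LinearIndependent K s} := ⟨fun s => by
      have := s.2.fintype_card_le_finrank
      rw [Fintype.card_fin] at this
      omega⟩
    exact Nat.card_of_isEmpty

theorem natCast_card_linearIndependent [Finite K] [Finite V] (k : ℕ) :
    (Nat.card {s : Fin k → V // LinearIndependent K s} : ℝ) =
      ∏ i ∈ Finset.range k,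
        ((Nat.card K : ℝ) ^ Module.finrank K V - (Nat.card K : ℝ) ^ i) := by
  rw [card_linearIndependent_eq_prod]
  have hK : 1 ≤ Nat.card K := Nat.card_pos
  by_cases hk : k ≤ Module.finrank K V
  · rw [Nat.cast_prod]
    refine Finset.prod_congr rfl fun i hi => ?_
    rw [Nat.cast_sub (Nat.pow_le_pow_right hK ((Finset.mem_range.1 hi).le.trans hk))]
    push_cast; rfl
  · push Not at hk
    have h0 : ∏ i ∈ Finset.range k, (Nat.card K ^ Module.finrank K V - Nat.card K ^ i) = 0 :=
      Finset.prod_eq_zero (Finset.mem_range.2 hk) (Nat.sub_self _)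
    rw [h0, Nat.cast_zero]
    exact (Finset.prod_eq_zero (Finset.mem_range.2 hk) (sub_self _)).symm

/-- Inclusion-exclusion for the injectivity of an endomorphism. -/
theorem sum_card_linearIndependent_ker [Finite K] [Finite V] (M : V →ₗ[K] V) :
    ∑ k ∈ Finset.range (Module.finrank K V + 1), (-1 : ℝ) ^ k / qFactorial (Nat.card K) k *
        (Nat.card {s : Fin k → LinearMap.ker M // LinearIndependent K s} : ℝ) =
      if LinearMap.ker M = ⊥ then 1 else 0 := by
  have : FiniteDimensional K V := Module.Finite.of_finite
  have hq : (1 : ℝ) < Nat.card K := by exact_mod_cast Finite.one_lt_card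
  -- A `k`-dimensional subspace has `q^(k choose 2) * qFactorial q k` ordered bases, so the
  -- coefficients give it total weight `(-1)^k q^(k choose 2)`, its Möbius value in the subspace
  -- lattice.
  simp_rw [natCast_card_linearIndependent]
  rw [sum_qBinomial_pow hq (Submodule.finrank_le _)]
  simp only [Submodule.finrank_eq_zero]

theorem exists_linearEquiv_apply_eq [Finite V] {ι : Type*} [Finite ι] {v w : ι → V}
    (hv : LinearIndependent K v) (hw : LinearIndependent K w) :
    ∃ g : V ≃ₗ[K] V, ∀ i, g (v i) = w i := by
  have : FiniteDimensional K V := Module.Finite.of_finite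
  obtain ⟨g, hg⟩ := Submodule.exists_linearEquiv_restrict_eq
    (hv.linearCombinationEquiv.symm ≪≫ₗ hw.linearCombinationEquiv)
  refine ⟨g, fun i => ?_⟩
  have h1 := hg (hv.linearCombinationEquiv (Finsupp.single i 1))
  simpa using h1.symm

/-- `GL(V)` acts transitively on independent `k`-tuples. Hence the fibres of `g ↦ g ∘ v` are in
bijection with one another, by composing with an automorphism that carries one target to another. -/
theorem card_linearEquiv_apply_eq [Finite V] {k : ℕ} {v w : Fin k → V}
    (hv : LinearIndependent K v) (hw : LinearIndependent K w) :
    Nat.card {g : V ≃ₗ[K] V // ∀ i, g (v i) = w i} *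
        Nat.card {s : Fin k → V // LinearIndependent K s} = Nat.card (V ≃ₗ[K] V) := by
  let f : (V ≃ₗ[K] V) → {s : Fin k → V // LinearIndependent K s} := fun g =>
    ⟨fun i => g (v i), hv.map' g.toLinearMap g.ker⟩
  choose t ht using fun u : {s : Fin k → V // LinearIndependent K s} =>
    exists_linearEquiv_apply_eq u.2 hw
  have e : ∀ u, {g // f g = u} ≃ {g : V ≃ₗ[K] V // ∀ i, g (v i) = w i} := fun u =>
    { toFun := fun g => ⟨g.1.trans (t u), fun i => by
        have h1 := congrFun (congrArg Subtype.val g.2) i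
        simp only [f] at h1
        simp [h1, ht]⟩
      invFun := fun g => ⟨g.1.trans (t u).symm, Subtype.ext <| funext fun i => by
        simp [f, g.2, ← ht u i]⟩
      left_inv := fun g => Subtype.ext <| LinearEquiv.ext fun x => by simp
      right_inv := fun g => Subtype.ext <| LinearEquiv.ext fun x => by simp }
  rw [Nat.card_congr ((Equiv.sigmaFiberEquiv f).symm.trans
    ((Equiv.sigmaCongrRight e).trans (Equiv.sigmaEquivProd _ _))), Nat.card_prod, mul_comm]

theorem card_linearIndependent_comp (D : V →ₗ[K] V) (k : ℕ) :
    Nat.card {s : Fin k → V // LinearIndependent K (D ∘ s)} =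
      Nat.card (LinearMap.ker D) ^ k *
        Nat.card {s : Fin k → LinearMap.range D // LinearIndependent K s} := by
  choose t ht using fun u : LinearMap.range D => u.2
  have hli : ∀ s : Fin k → LinearMap.range D, LinearIndependent K s ↔
      LinearIndependent K (fun i => (s i : V)) := fun s =>
    (LinearMap.linearIndependent_iff (LinearMap.range D).subtype
      (Submodule.ker_subtype _)).symm
  let e : {s : Fin k → V // LinearIndependent K (D ∘ s)} ≃
      -- The section `t` of `D` splits each vector into a kernel component and its image under `D`;
      -- only the images are constrained.
      (Fin k → LinearMap.ker D) ×
        {s : Fin k → LinearMap.range D // LinearIndependent K s} :=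
    { toFun := fun s => (fun i => ⟨s.1 i - t ⟨D (s.1 i), LinearMap.mem_range_self D _⟩, by
          rw [LinearMap.mem_ker, map_sub, ht, sub_self]⟩,
        ⟨fun i => ⟨D (s.1 i), LinearMap.mem_range_self D _⟩, (hli _).2 s.2⟩)
      invFun := fun p => ⟨fun i => p.1 i + t (p.2.1 i), by
        have h1 : D ∘ (fun i => (p.1 i : V) + t (p.2.1 i)) = fun i => (p.2.1 i : V) := by
          funext i
          have h2 : D (p.1 i : V) = 0 := LinearMap.mem_ker.1 (p.1 i).2
          simp [h2, ht]
        rw [h1]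
        exact (hli _).1 p.2.2⟩
      left_inv := fun s => Subtype.ext <| funext fun i => by simp
      right_inv := fun p => by
        have h2 : ∀ i, (⟨D ((p.1 i : V) + t (p.2.1 i)), LinearMap.mem_range_self D _⟩ :
            LinearMap.range D) = p.2.1 i := fun i => Subtype.ext <| by
          have h2 : D (p.1 i : V) = 0 := LinearMap.mem_ker.1 (p.1 i).2
          simp [h2, ht]
        refine Prod.ext (funext fun i => Subtype.ext ?_) (Subtype.ext (funext h2))
        simp only [h2]
        simp }
  rw [Nat.card_congr e, Nat.card_prod, Nat.card_fun, Nat.card_fin]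

theorem card_linearIndependent_comp_div [Finite K] [Finite V] (D : V →ₗ[K] V) (k : ℕ) :
    (Nat.card {s : Fin k → V // LinearIndependent K (D ∘ s)} : ℝ) /
        Nat.card {s : Fin k → V // LinearIndependent K s} =
      indepRatio (Nat.card K) (Nat.card (LinearMap.ker D)) (Module.finrank K V) k := by
  have : FiniteDimensional K V := Module.Finite.of_finite
  have h1 : Nat.card K ^ Module.finrank K V =
      Nat.card (LinearMap.ker D) * Nat.card K ^ Module.finrank K (LinearMap.range D) := by
    rw [Module.natCard_eq_pow_finrank (K := K) (V := LinearMap.ker D), ← pow_add, add_comm,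
      LinearMap.finrank_range_add_finrank_ker]
  rw [card_linearIndependent_comp, card_linearIndependent_eq_prod,
    card_linearIndependent_eq_prod, indepRatio, Finset.prod_div_distrib, Nat.cast_prod, h1,
    ← Nat.cast_prod, ← Nat.cast_prod]
  -- With `r` the rank of `D` and `h = |ker D|`, `q^n = h q^r`, so `h (q^r - q^i) = q^n - h q^i`.
  -- This holds for truncated subtraction too, so no bound on `k` is needed.
  congr 2
  rw [← Finset.card_range k, ← Finset.prod_const, Finset.card_range, ← Finset.prod_mul_distrib]
  exact Finset.prod_congr rfl fun i _ => Nat.mul_sub _ _ _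

/-- The number of automorphisms `g` with `g + D` injective. -/
theorem card_linearEquiv_add_injective [Finite K] [Finite V] (D : V →ₗ[K] V) :
    (Nat.card {g : V ≃ₗ[K] V // LinearMap.ker (g.toLinearMap + D) = ⊥} : ℝ) =
      Nat.card (V ≃ₗ[K] V) * ∑ k ∈ Finset.range (Module.finrank K V + 1),
        (-1) ^ k / qFactorial (Nat.card K) k *
          indepRatio (Nat.card K) (Nat.card (LinearMap.ker D)) (Module.finrank K V) k := by
  classical
  have : FiniteDimensional K V := Module.Finite.of_finite
  have : Finite (V ≃ₗ[K] V) := Finite.of_injective _ DFunLike.coe_injective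
  have := Fintype.ofFinite (V ≃ₗ[K] V)
  have step : ∀ k ∈ Finset.range (Module.finrank K V + 1),
      ∑ g : V ≃ₗ[K] V, (Nat.card {s : Fin k → LinearMap.ker (g.toLinearMap + D) //
        LinearIndependent K s} : ℝ) = Nat.card (V ≃ₗ[K] V) *
          indepRatio (Nat.card K) (Nat.card (LinearMap.ker D)) (Module.finrank K V) k := by
    intro k hk
    have hli : ∀ g : V ≃ₗ[K] V, ∀ s : Fin k → LinearMap.ker (g.toLinearMap + D),
        LinearIndependent K s ↔ LinearIndependent K (fun i => (s i : V)) := fun g s =>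
      (LinearMap.linearIndependent_iff (LinearMap.ker (g.toLinearMap + D)).subtype
        (Submodule.ker_subtype _)).symm
    have hD : ∀ s : Fin k → V, LinearIndependent K (D ∘ s) →
        LinearIndependent K (fun i => -D (s i)) := fun s hs =>
      hs.map' (-LinearMap.id) (by simp)
    have hD' : ∀ (g : V ≃ₗ[K] V) (s : Fin k → V), LinearIndependent K s →
        (∀ i, g (s i) = -D (s i)) → LinearIndependent K (D ∘ s) := fun g s hs h => by
      have h1 : D ∘ s = (-g.toLinearMap) ∘ s := funext fun i => by simp [h]
      rw [h1]
      exact hs.map' _ (by simp)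
    -- Exchange of summation: a tuple lies in `ker (g + D)` iff `g` sends it to `-D s`. As `g`
    -- preserves independence, only tuples with `D ∘ s` independent occur, and each is hit by the
    -- same number of `g`.
    let e : (Σ g : V ≃ₗ[K] V, {s : Fin k → LinearMap.ker (g.toLinearMap + D) //
        LinearIndependent K s}) ≃ (Σ s : {s : Fin k → V // LinearIndependent K (D ∘ s)},
          {g : V ≃ₗ[K] V // ∀ i, g (s.1 i) = -D (s.1 i)}) :=
      { toFun := fun p =>
          have hp : ∀ i, p.1 (p.2.1 i : V) = -D (p.2.1 i) := fun i =>
            eq_neg_of_add_eq_zero_left (LinearMap.mem_ker.1 (p.2.1 i).2)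
          ⟨⟨fun i => (p.2.1 i : V), hD' p.1 _ ((hli _ _).1 p.2.2) hp⟩, ⟨p.1, hp⟩⟩
        invFun := fun p => ⟨p.2.1, ⟨fun i => ⟨p.1.1 i, by
          rw [LinearMap.mem_ker, LinearMap.add_apply, LinearEquiv.coe_coe, p.2.2,
            neg_add_cancel]⟩, (hli _ _).2 (LinearIndependent.of_comp D p.1.2)⟩⟩
        left_inv := fun p => rfl
        right_inv := fun p => rfl }
    rw [← card_linearIndependent_comp_div, ← Nat.cast_sum, ← Nat.card_sigma, Nat.card_congr e]
    have hpos : (Nat.card {s : Fin k → V // LinearIndependent K s} : ℝ) ≠ 0 := by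
      rw [natCast_card_linearIndependent]
      have hq : (1 : ℝ) < Nat.card K := by exact_mod_cast Finite.one_lt_card
      refine Finset.prod_ne_zero_iff.2 fun i hi => sub_ne_zero.2 (ne_of_gt ?_)
      exact pow_lt_pow_right₀ hq (by simp only [Finset.mem_range] at hi hk; omega)
    rw [mul_div_assoc', eq_div_iff hpos]
    have := Fintype.ofFinite {s : Fin k → V // LinearIndependent K (D ∘ s)}
    rw [Nat.card_sigma]
    norm_cast
    rw [Finset.sum_mul, Finset.sum_congr rfl fun s _ => card_linearEquiv_apply_eq
      (LinearIndependent.of_comp D s.2) (hD _ s.2)]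
    simp [mul_comm]
  have h0 : (Nat.card {g : V ≃ₗ[K] V // LinearMap.ker (g.toLinearMap + D) = ⊥} : ℝ) =
      ∑ g : V ≃ₗ[K] V, if LinearMap.ker (g.toLinearMap + D) = ⊥ then (1 : ℝ) else 0 := by
    rw [Nat.card_eq_fintype_card, Fintype.card_subtype, Finset.sum_boole]
  simp_rw [h0, ← sum_card_linearIndependent_ker]
  rw [Finset.sum_comm, Finset.mul_sum]
  refine Finset.sum_congr rfl fun k hk => ?_
  rw [← Finset.mul_sum, step k hk]
  ring

/-- The number of invertible matrices `y` with `1 + D y` invertible. -/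
theorem card_isUnit_and_isUnit [Finite K] {n : ℕ} (D : Matrix (Fin n) (Fin n) K) :
    (Nat.card {y : Matrix (Fin n) (Fin n) K // IsUnit y ∧ IsUnit (1 + D * y)} : ℝ) =
      Nat.card {y : Matrix (Fin n) (Fin n) K // IsUnit y} *
        ∑ k ∈ Finset.range (n + 1), (-1) ^ k / qFactorial (Nat.card K) k *
          indepRatio (Nat.card K) (Nat.card (LinearMap.ker D.mulVecLin)) n k := by
  let V := Fin n → K
  let E : (Matrix (Fin n) (Fin n) K)ˣ ≃ (V ≃ₗ[K] V) :=
    ((Units.mapEquiv (Matrix.toLinAlgEquiv' (R := K) (n := Fin n)).toMulEquiv).trans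
      (LinearMap.GeneralLinearGroup.generalLinearEquiv K V)).toEquiv
  have hE : ∀ u, (E u).toLinearMap = u.1.mulVecLin := fun u => rfl
  let U : (Matrix (Fin n) (Fin n) K)ˣ ≃ {y : Matrix (Fin n) (Fin n) K // IsUnit y} :=
    { toFun := fun u => ⟨u, u.isUnit⟩
      invFun := fun y => y.2.unit
      left_inv := fun u => Units.ext rfl
      right_inv := fun y => rfl }
  -- The substitution `g = y⁻¹` works because `1 + D y = (y⁻¹ + D) y`.
  let F : {y : Matrix (Fin n) (Fin n) K // IsUnit y ∧ IsUnit (1 + D * y)} ≃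
      {g : V ≃ₗ[K] V // LinearMap.ker (g.toLinearMap + D.mulVecLin) = ⊥} :=
    (Equiv.subtypeSubtypeEquivSubtypeInter _ _).symm.trans
      (((U.symm.trans (Equiv.inv _)).trans E).subtypeEquiv fun y => by
        have h1 : (E (y.2.unit)⁻¹).toLinearMap + D.mulVecLin =
            (((y.2.unit)⁻¹ : (Matrix (Fin n) (Fin n) K)ˣ).1 + D).mulVecLin := by
          rw [hE, Matrix.mulVecLin_add]
        have h2 : 1 + D * y.1 =
            (((y.2.unit)⁻¹ : (Matrix (Fin n) (Fin n) K)ˣ).1 + D) * y.2.unit.1 := by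
          rw [add_mul, Units.inv_mul]; rfl
        change IsUnit (1 + D * y.1) ↔
          LinearMap.ker ((E (y.2.unit)⁻¹).toLinearMap + D.mulVecLin) = ⊥
        rw [h1, h2, Units.isUnit_mul_units, LinearMap.ker_eq_bot, Matrix.coe_mulVecLin,
          Matrix.mulVec_injective_iff_isUnit])
  rw [Nat.card_congr F, card_linearEquiv_add_injective, ← Nat.card_congr E, Nat.card_congr U,
    Module.finrank_fin_fun]

end FiniteField

/-! ### Finite length modules and their presentations -/

open IsLocalRing

/-- Induction on length: a simple quotient `M / N` is a copy of the finite residue field, so `𝔪 M ⊆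
N` and each step costs one more power of `𝔪`. -/
theorem finite_of_isFiniteLength {R H : Type*} [CommRing R] [IsLocalRing R]
    [Finite (ResidueField R)] [AddCommGroup H] [Module R H] (hH : IsFiniteLength R H) :
    Finite H ∧ ∃ e : ℕ, ∀ a ∈ maximalIdeal R ^ e, ∀ x : H, a • x = 0 := by
  induction hH with
  | of_subsingleton => exact ⟨inferInstance, 0, fun _ _ _ => Subsingleton.elim _ _⟩
  | @of_simple_quotient M _ _ N hs _ ih =>
    obtain ⟨hN, e, he⟩ := ih
    obtain ⟨I, hI, ⟨f⟩⟩ := isSimpleModule_iff_quot_maximal.1 hs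
    obtain rfl := eq_maximalIdeal hI
    have h1 : Finite (R ⧸ maximalIdeal R) := inferInstanceAs (Finite (ResidueField R))
    have h2 : Finite (M ⧸ N) := Finite.of_equiv _ f.symm.toEquiv
    have h4 : Finite M := @Finite.of_addSubgroup_quotient M _ N.toAddSubgroup hN h2
    refine ⟨h4, e + 1, fun a ha x => ?_⟩
    have h3 : ∀ b ∈ maximalIdeal R, ∀ x : M, b • x ∈ N := fun b hb x => by
      rw [← Submodule.Quotient.mk_eq_zero, Submodule.Quotient.mk_smul]
      apply f.injective
      rw [map_smul, map_zero]
      obtain ⟨c, hc⟩ := Ideal.Quotient.mk_surjective (f (Submodule.Quotient.mk x))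
      rw [← hc, Algebra.smul_def, Ideal.Quotient.algebraMap_eq, ← map_mul]
      exact Ideal.Quotient.eq_zero_iff_mem.2 (Ideal.mul_mem_right _ _ hb)
    rw [pow_succ] at ha
    refine Submodule.smul_induction_on (p := fun a => a • x = 0) ha
      (fun c hc b hb => ?_) (fun b c hb hc => by rw [add_smul, hb, hc, add_zero])
    rw [smul_eq_mul, mul_smul]
    exact congrArg Subtype.val (he c hc ⟨b • x, h3 b hb x⟩)

section Surjections

variable {R H : Type*} [CommRing R] [AddCommGroup H] [Module R H]

instance finite_linearMap_pi [Finite H] (n : ℕ) : Finite ((Fin n → R) →ₗ[R] H) :=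
  Finite.of_equiv _ ((Pi.basisFun R (Fin n)).constr ℕ).toEquiv

/-- All but a vanishing proportion of the homomorphisms `R^n → H` are surjective. -/
theorem tendsto_card_surjective_div [Finite H] :
    Tendsto (fun n : ℕ => (Nat.card {F : (Fin n → R) →ₗ[R] H // Function.Surjective F} : ℝ) /
      (Nat.card H : ℝ) ^ n) atTop (𝓝 1) := by
  classical
  have := Fintype.ofFinite {M : Submodule R H // M ≠ ⊤}
  have hpos : (0 : ℝ) < Nat.card H := by exact_mod_cast Nat.card_pos
  have hcard : ∀ n : ℕ, Nat.card ((Fin n → R) →ₗ[R] H) = Nat.card H ^ n := fun n => by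
    rw [← Nat.card_congr ((Pi.basisFun R (Fin n)).constr ℕ (M' := H)).toEquiv, Nat.card_fun,
      Nat.card_fin]
  -- A map that is not surjective lands in one of the finitely many proper submodules `M`, and each
  -- of these contributes a proportion `(|M| / |H|)^n → 0`.
  have hbound : ∀ n : ℕ, Nat.card {F : (Fin n → R) →ₗ[R] H // ¬ Function.Surjective F} ≤
      ∑ M : {M : Submodule R H // M ≠ ⊤}, Nat.card M.1 ^ n := fun n => by
    have h1 : ∑ M : {M : Submodule R H // M ≠ ⊤}, Nat.card M.1 ^ n =
        Nat.card (Σ M : {M : Submodule R H // M ≠ ⊤}, (Fin n → M.1)) := by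
      rw [Nat.card_sigma]
      exact Finset.sum_congr rfl fun M _ => by rw [Nat.card_fun, Nat.card_fin]
    rw [h1]
    refine Nat.card_le_card_of_injective (fun F => ⟨⟨LinearMap.range F.1, fun h =>
      F.2 (LinearMap.range_eq_top.1 h)⟩, fun i => ⟨F.1 (Pi.single i 1),
        LinearMap.mem_range_self _ _⟩⟩) fun F G h => ?_
    have h2 : ∀ i, F.1 (Pi.single i 1) = G.1 (Pi.single i 1) := fun i =>
      congrArg (fun p : (Σ M : {M : Submodule R H // M ≠ ⊤}, (Fin n → M.1)) => (p.2 i : H)) h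
    exact Subtype.ext ((Pi.basisFun R (Fin n)).ext fun i => by simpa using h2 i)
  have hsum : Tendsto (fun n : ℕ => 1 - ∑ M : {M : Submodule R H // M ≠ ⊤},
      ((Nat.card M.1 : ℝ) / Nat.card H) ^ n) atTop (𝓝 1) := by
    have : Tendsto (fun n : ℕ => 1 - ∑ M : {M : Submodule R H // M ≠ ⊤},
        ((Nat.card M.1 : ℝ) / Nat.card H) ^ n) atTop
        (𝓝 (1 - ∑ M : {M : Submodule R H // M ≠ ⊤}, 0)) := by
      refine (tendsto_finsetSum _ fun M _ => ?_).const_sub 1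
      refine tendsto_pow_atTop_nhds_zero_of_lt_one (by positivity) ?_
      rw [div_lt_one hpos]
      exact_mod_cast (Set.ncard_lt_card fun h => M.2 (SetLike.coe_injective h) :
        (M.1 : Set H).ncard < Nat.card H)
    simpa using this
  have htot : ∀ n : ℕ, (Nat.card H : ℝ) ^ n =
      Nat.card {F : (Fin n → R) →ₗ[R] H // Function.Surjective F} +
        Nat.card {F : (Fin n → R) →ₗ[R] H // ¬ Function.Surjective F} := fun n => by
    rw [← Nat.cast_pow, ← hcard, ← Nat.cast_add, ← Nat.card_sum,
      Nat.card_congr (Equiv.sumCompl _)]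
  refine tendsto_of_tendsto_of_tendsto_of_le_of_le hsum tendsto_const_nhds (fun n => ?_)
    fun n => ?_
  · have h1 : (Nat.card {F : (Fin n → R) →ₗ[R] H // ¬ Function.Surjective F} : ℝ) ≤
        ∑ M : {M : Submodule R H // M ≠ ⊤}, (Nat.card M.1 : ℝ) ^ n := by
      exact_mod_cast hbound n
    have h2 := htot n
    simp only [div_pow, ← Finset.sum_div]
    rw [le_div_iff₀ (by positivity), sub_mul, one_mul, div_mul_cancel₀ _ (by positivity)]
    linarith
  · refine div_le_one_of_le₀ ?_ (by positivity)
    have h2 := htot n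
    have h3 : (0 : ℝ) ≤ Nat.card {F : (Fin n → R) →ₗ[R] H // ¬ Function.Surjective F} :=
      Nat.cast_nonneg _
    linarith

/-- Each module isomorphic to `H` has `|Aut H|` presentations with given relations. -/
theorem card_surjective_ker_eq {n : ℕ} (X : Matrix (Fin n) (Fin n) R) [Decidable
    (Nonempty (Coker X ≃ₗ[R] H))] :
    Nat.card {F : {F : (Fin n → R) →ₗ[R] H // Function.Surjective F} //
        LinearMap.ker F.1 = LinearMap.range X.mulVecLin} =
      if Nonempty (Coker X ≃ₗ[R] H) then Nat.card (H ≃ₗ[R] H) else 0 := by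
  split_ifs with h
  · obtain ⟨e⟩ := h
    let p := (LinearMap.range X.mulVecLin).mkQ
    have hp : Function.Surjective p := Submodule.mkQ_surjective _
    -- Given one isomorphism `e`, every surjection with this kernel is `σ ∘ e ∘ p` for a unique
    -- automorphism `σ`.
    refine (Nat.card_congr (Equiv.ofBijective (fun σ : H ≃ₗ[R] H =>
      (⟨⟨(e.trans σ).toLinearMap ∘ₗ p, (e.trans σ).surjective.comp hp⟩, by
        rw [LinearMap.ker_comp, LinearEquiv.ker, Submodule.comap_bot, Submodule.ker_mkQ]⟩ :
          {F : {F : (Fin n → R) →ₗ[R] H // Function.Surjective F} //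
            LinearMap.ker F.1 = LinearMap.range X.mulVecLin})) ⟨fun σ τ hστ => ?_,
              fun F => ?_⟩)).symm
    · refine LinearEquiv.ext fun x => ?_
      obtain ⟨y, hy⟩ := (e.surjective.comp hp) x
      have h1 := LinearMap.congr_fun (congrArg (fun F => F.1.1) hστ) y
      rw [← hy]
      exact h1
    · refine ⟨e.symm.trans ((Submodule.quotEquivOfEq _ _ F.2.symm).trans
        (F.1.1.quotKerEquivOfSurjective F.1.2)), Subtype.ext (Subtype.ext
          (LinearMap.ext fun x => ?_))⟩
      simp [p]
  · have : IsEmpty {F : {F : (Fin n → R) →ₗ[R] H // Function.Surjective F} //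
        LinearMap.ker F.1 = LinearMap.range X.mulVecLin} :=
      ⟨fun F => h ⟨(Submodule.quotEquivOfEq _ _ F.2.symm).trans
        (F.1.1.quotKerEquivOfSurjective F.1.2)⟩⟩
    exact Nat.card_of_isEmpty

end Surjections

/-! ### Reduction modulo the maximal ideal -/

section Reduction

variable {R : Type*} [CommRing R] [IsLocalRing R]

/-- Entrywise reduction of a matrix modulo the maximal ideal. -/
noncomputable def red (n : ℕ) :
    Matrix (Fin n) (Fin n) R →+* Matrix (Fin n) (Fin n) (ResidueField R) :=
  (residue R).mapMatrix

theorem red_surjective (n : ℕ) : Function.Surjective (red (R := R) n) := fun y => by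
  choose x hx using fun i j => residue_surjective (y i j)
  exact ⟨Matrix.of x, Matrix.ext hx⟩

theorem isUnit_red_iff {n : ℕ} {X : Matrix (Fin n) (Fin n) R} :
    IsUnit (red n X) ↔ IsUnit X := by
  rw [Matrix.isUnit_iff_isUnit_det, Matrix.isUnit_iff_isUnit_det, red, ← RingHom.map_det,
    isUnit_map_iff]

theorem exists_eq_mul_of_range_le {R : Type*} [CommRing R] {n : ℕ} {D X : Matrix (Fin n) (Fin n) R}
    (h : LinearMap.range X.mulVecLin ≤ LinearMap.range D.mulVecLin) : ∃ Y, X = D * Y := by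
  choose y hy using fun j => h (LinearMap.mem_range_self X.mulVecLin (Pi.single j 1))
  refine ⟨Matrix.of fun i j => y j i, Matrix.ext fun i j => ?_⟩
  have := congrFun (hy j) i
  simp only [Matrix.mulVecLin_apply, Matrix.mulVec_single_one] at this
  rw [Matrix.col_apply] at this
  rw [← this]
  rfl

/-- A matrix with image inside `im D` factors as `D Y`. Injectivity of `D` turns equality of images
into surjectivity, hence invertibility, of `Y`. Over a local ring invertibility is visible after
reduction. -/
theorem range_eq_and_isUnit_iff {n : ℕ} {D X : Matrix (Fin n) (Fin n) R}
    (hD : Function.Injective D.mulVec) :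
    (LinearMap.range X.mulVecLin = LinearMap.range D.mulVecLin ∧ IsUnit (1 + X)) ↔
      ∃ Y, X = D * Y ∧ IsUnit (red n Y) ∧ IsUnit (1 + red n D * red n Y) := by
  constructor
  · rintro ⟨h1, h2⟩
    obtain ⟨Y, rfl⟩ := exists_eq_mul_of_range_le h1.le
    refine ⟨Y, rfl, ?_, ?_⟩
    · rw [isUnit_red_iff, ← Matrix.mulVec_surjective_iff_isUnit]
      intro v
      obtain ⟨w, hw⟩ := h1.ge (LinearMap.mem_range_self D.mulVecLin v)
      refine ⟨w, hD ?_⟩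
      simpa using hw
    · rw [← map_mul, ← map_one (red n), ← map_add, isUnit_red_iff]
      exact h2
  · rintro ⟨Y, rfl, h1, h2⟩
    rw [← map_mul, ← map_one (red n), ← map_add, isUnit_red_iff] at h2
    rw [isUnit_red_iff, ← Matrix.mulVec_surjective_iff_isUnit] at h1
    refine ⟨?_, h2⟩
    rw [Matrix.mulVecLin_mul, LinearMap.range_comp_of_range_eq_top]
    exact LinearMap.range_eq_top.2 h1

theorem mem_smul_top_pi {R : Type*} [CommRing R] {I : Ideal R} {n : ℕ} {x : Fin n → R} :
    x ∈ I • (⊤ : Submodule R (Fin n → R)) ↔ ∀ i, x i ∈ I := by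
  constructor
  · intro h
    exact Submodule.smul_induction_on (p := fun x => ∀ i, x i ∈ I) h
      (fun a ha y _ i => Ideal.mul_mem_right _ _ ha) (fun x y hx hy i => I.add_mem (hx i) (hy i))
  · intro h
    rw [pi_eq_sum_univ x]
    exact Submodule.sum_mem _ fun i _ => Submodule.smul_mem_smul (h i) trivial

variable {H : Type*} [AddCommGroup H] [Module R H]

/-- The corank of the reduction of `D` is the minimal number of generators of its cokernel. -/
theorem card_ker_red [Finite (ResidueField R)] {n : ℕ} {D : Matrix (Fin n) (Fin n) R}
    {F : (Fin n → R) →ₗ[R] H}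
    (hF : Function.Surjective F) (hDF : LinearMap.range D.mulVecLin = LinearMap.ker F) :
    Nat.card (LinearMap.ker (red n D).mulVecLin) =
      Nat.card (H ⧸ (maximalIdeal R • ⊤ : Submodule R H)) := by
  let ρ : (Fin n → R) →+ (Fin n → ResidueField R) := (residue R).toAddMonoidHom.compLeft (Fin n)
  have hρ : Function.Surjective ρ := fun y => by
    choose x hx using fun i => residue_surjective (y i)
    exact ⟨x, funext hx⟩
  have hρ0 : ∀ x, ρ x = 0 ↔ x ∈ maximalIdeal R • (⊤ : Submodule R (Fin n → R)) := fun x => by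
    rw [mem_smul_top_pi, funext_iff]
    exact forall_congr' fun i => residue_eq_zero_iff _
  have hρD : ∀ y, ρ (D.mulVec y) = (red n D).mulVec (ρ y) := fun y =>
    funext fun i => RingHom.map_mulVec (residue R) D y i
  -- Both preimages are `𝔪 R^n + im D`, so `im D̄` and `𝔪H` have the same index. The index of `im
  -- D̄` equals `|ker D̄|` by rank-nullity.
  have hcomap : (LinearMap.range (red n D).mulVecLin).toAddSubgroup.comap ρ =
      (maximalIdeal R • ⊤ : Submodule R H).toAddSubgroup.comap F.toAddMonoidHom := by
    ext x
    change ρ x ∈ LinearMap.range (red n D).mulVecLin ↔ F x ∈ maximalIdeal R • (⊤ : Submodule R H)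
    have hmap : maximalIdeal R • (⊤ : Submodule R H) =
        (maximalIdeal R • (⊤ : Submodule R (Fin n → R))).map F := by
      rw [Submodule.map_smul'', Submodule.map_top, LinearMap.range_eq_top.2 hF]
    rw [hmap]
    constructor
    · rintro ⟨y', hy⟩
      obtain ⟨y, rfl⟩ := hρ y'
      have h1 : D.mulVec y ∈ LinearMap.ker F := hDF ▸ LinearMap.mem_range_self D.mulVecLin y
      refine ⟨x - D.mulVec y, (hρ0 _).1 ?_, ?_⟩
      · rw [map_sub, hρD, ← hy]; simp
      · rw [map_sub, LinearMap.mem_ker.1 h1, sub_zero]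
    · rintro ⟨z, hz, hzx⟩
      have h1 : x - z ∈ LinearMap.range D.mulVecLin := by
        rw [hDF, LinearMap.mem_ker, map_sub, hzx, sub_self]
      obtain ⟨y, hy⟩ := h1
      refine ⟨ρ y, ?_⟩
      rw [Matrix.mulVecLin_apply] at hy ⊢
      rw [← hρD, hy, map_sub, (hρ0 z).2 hz, sub_zero]
  have h1 := congrArg AddSubgroup.index hcomap
  rw [AddSubgroup.index_comap_of_surjective _ hρ, AddSubgroup.index_comap_of_surjective _
    (f := F.toAddMonoidHom) hF] at h1
  have h2 : (LinearMap.range (red n D).mulVecLin).toAddSubgroup.index *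
      Nat.card (LinearMap.range (red n D).mulVecLin) = Nat.card (Fin n → ResidueField R) :=
    (LinearMap.range (red n D).mulVecLin).toAddSubgroup.index_mul_card
  have h3 : Nat.card (LinearMap.range (red n D).mulVecLin) *
      Nat.card (LinearMap.ker (red n D).mulVecLin) = Nat.card (Fin n → ResidueField R) := by
    rw [Module.natCard_eq_pow_finrank (K := ResidueField R)
        (V := LinearMap.range (red n D).mulVecLin),
      Module.natCard_eq_pow_finrank (K := ResidueField R)
        (V := LinearMap.ker (red n D).mulVecLin), ← pow_add,
      LinearMap.finrank_range_add_finrank_ker,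
      ← Module.natCard_eq_pow_finrank (K := ResidueField R)]
  rw [mul_comm, ← h2, h1] at h3
  exact Nat.eq_of_mul_eq_mul_right Nat.card_pos h3

end Reduction

/-- Kernels of surjections onto modules of finite length are images of injective matrices. -/
theorem exists_matrix_range_eq_ker {R H : Type*} [CommRing R] [IsDomain R]
    [IsDiscreteValuationRing R] [AddCommGroup H] [Module R H] {e : ℕ}
    (he : ∀ a ∈ maximalIdeal R ^ e, ∀ x : H, a • x = 0) {n : ℕ} (F : (Fin n → R) →ₗ[R] H) :
    ∃ D : Matrix (Fin n) (Fin n) R, Function.Injective D.mulVec ∧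
      LinearMap.range D.mulVecLin = LinearMap.ker F := by
  obtain ⟨ϖ, hϖ⟩ := IsDiscreteValuationRing.exists_irreducible R
  have hϖe : ϖ ^ e ∈ maximalIdeal R ^ e := Ideal.pow_mem_pow ((mem_maximalIdeal _).2 hϖ.1) e
  -- Multiplication by `ϖ^e` kills `H`, so it embeds `R^n` in `ker F`. This forces rank `n`, and
  -- `ker F` is free over a principal ideal domain.
  let j : (Fin n → R) →ₗ[R] LinearMap.ker F :=
    LinearMap.codRestrict _ (LinearMap.lsmul R (Fin n → R) (ϖ ^ e)) fun x => by
      rw [LinearMap.mem_ker, LinearMap.lsmul_apply, map_smul, he _ hϖe]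
  have hj : Function.Injective j := fun x y h => by
    have h1 : ϖ ^ e • x = ϖ ^ e • y := congrArg Subtype.val h
    exact smul_right_injective _ (pow_ne_zero e hϖ.ne_zero) h1
  have hrank : Module.finrank R (Fin n → R) = Module.finrank R (LinearMap.ker F) :=
    le_antisymm (LinearMap.finrank_le_finrank_of_injective hj) (Submodule.finrank_le _)
  let g : (Fin n → R) ≃ₗ[R] LinearMap.ker F := LinearEquiv.ofFinrankEq _ _ hrank
  have hD : (LinearMap.toMatrix' ((LinearMap.ker F).subtype ∘ₗ g.toLinearMap)).mulVecLin =
      (LinearMap.ker F).subtype ∘ₗ g.toLinearMap := Matrix.toLin'_toMatrix' _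
  refine ⟨LinearMap.toMatrix' ((LinearMap.ker F).subtype ∘ₗ g.toLinearMap), ?_, ?_⟩
  · rw [← Matrix.coe_mulVecLin, hD]
    exact Subtype.val_injective.comp g.injective
  · rw [hD, LinearMap.range_comp, LinearEquiv.range, Submodule.map_top, Submodule.range_subtype]

open scoped Pointwise

attribute [local instance] matTopology matBorel

/-! ### Open subgroups of the matrix group -/

section Topology

variable {R : Type*} [CommRing R] [IsLocalRing R]

theorem isOpen_addSubgroup_of_pow_le {n : ℕ} (U : AddSubgroup (Matrix (Fin n) (Fin n) R)) (L : ℕ)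
    (hU : ∀ X : Matrix (Fin n) (Fin n) R, (∀ i j, X i j ∈ maximalIdeal R ^ L) → X ∈ U) :
    IsOpen (U : Set (Matrix (Fin n) (Fin n) R)) := by
  have := mat_isTopologicalAddGroup R n
  let _ : TopologicalSpace R := (maximalIdeal R).adicTopology
  refine U.isOpen_of_mem_nhds (g := 0) (Filter.mem_of_superset ?_ hU)
  have h1 : ((maximalIdeal R ^ L : Ideal R) : Set R) ∈ 𝓝 (0 : R) :=
    (maximalIdeal R).hasBasis_nhds_zero_adic.mem_of_mem trivial
  have h2 : ∀ i j, ∀ᶠ X : Matrix (Fin n) (Fin n) R in 𝓝 0, X i j ∈ maximalIdeal R ^ L :=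
    fun i j => (continuous_id.matrix_elem i j).continuousAt.eventually
      (p := fun x => x ∈ maximalIdeal R ^ L) h1
  exact eventually_all.2 fun i => eventually_all.2 fun j => h2 i j

end Topology

/-! ### Haar measure of affine sets -/

section Measure

variable {R : Type*} [CommRing R] [IsDomain R] [IsDiscreteValuationRing R]
  [IsAdicComplete (maximalIdeal R) R] [Finite (ResidueField R)]

theorem matHaar_univ (n : ℕ) : matHaar R n Set.univ = 1 := by
  have := mat_borelSpace R n
  have := mat_isTopologicalAddGroup R n
  have := mat_compactSpace R n
  exact Measure.addHaarMeasure_self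

instance isProbabilityMeasure_matHaar (n : ℕ) : IsProbabilityMeasure (matHaar R n) :=
  ⟨matHaar_univ n⟩

theorem isAddLeftInvariant_matHaar (n : ℕ) : (matHaar R n).IsAddLeftInvariant := by
  have := mat_borelSpace R n
  have := mat_isTopologicalAddGroup R n
  have := mat_compactSpace R n
  exact inferInstanceAs (Measure.addHaarMeasure _).IsAddLeftInvariant

theorem measurableAdd_mat {R : Type*} [CommRing R] [IsLocalRing R] (n : ℕ) :
    MeasurableConstVAdd (Matrix (Fin n) (Fin n) R) (Matrix (Fin n) (Fin n) R) := by
  have := mat_borelSpace R n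
  have := mat_isTopologicalAddGroup R n
  exact ⟨fun c => (continuous_const_add c).measurable⟩

variable {H : Type*} [AddCommGroup H] [Module R H] {n : ℕ}

/-- The additive group of the matrices `D Y` with `Y` zero modulo the maximal ideal. -/
noncomputable def mulKerRed {R : Type*} [CommRing R] [IsLocalRing R] {n : ℕ}
    (D : Matrix (Fin n) (Fin n) R) : AddSubgroup (Matrix (Fin n) (Fin n) R) :=
  (red n).toAddMonoidHom.ker.map (AddMonoidHom.mulLeft D)

theorem mulLeft_injective {R : Type*} [CommRing R] {n : ℕ} {D : Matrix (Fin n) (Fin n) R}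
    (hD : Function.Injective D.mulVec) : Function.Injective (AddMonoidHom.mulLeft D) :=
  fun X Y h => Matrix.ext fun i j => congrFun (hD (a₁ := X.col j) (a₂ := Y.col j)
    (congrArg (fun M : Matrix (Fin n) (Fin n) R => M.col j) h)) i

/-- The index factors through `D · Mat_n(R)`. That group is the kernel of applying `F` to each
column, of index `|H|^n`; inside it, injectivity of `D` identifies the quotient with the matrices
over the residue field. -/
theorem index_mulKerRed {R H : Type*} [CommRing R] [IsLocalRing R] [AddCommGroup H] [Module R H]
    {n : ℕ} {D : Matrix (Fin n) (Fin n) R} (hD : Function.Injective D.mulVec)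
    {F : (Fin n → R) →ₗ[R] H} (hF : Function.Surjective F)
    (hDF : LinearMap.range D.mulVecLin = LinearMap.ker F) :
    (mulKerRed D).index =
      Nat.card (Matrix (Fin n) (Fin n) (ResidueField R)) * Nat.card H ^ n := by
  have hinj := mulLeft_injective hD
  let Φ : Matrix (Fin n) (Fin n) R →+ (Fin n → H) :=
    { toFun := fun X j => F (X.col j)
      map_zero' := funext fun j => map_zero F
      map_add' := fun X Y => funext fun j => map_add F _ _ }
  have hΦ : Function.Surjective Φ := fun h => by
    choose x hx using fun j => hF (h j)
    exact ⟨Matrix.of fun i j => x j i, funext hx⟩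
  have hker : Φ.ker = (⊤ : AddSubgroup _).map (AddMonoidHom.mulLeft D) := by
    ext X
    constructor
    · intro hX
      have h1 : LinearMap.range X.mulVecLin ≤ LinearMap.range D.mulVecLin := by
        rw [hDF, Matrix.range_mulVecLin, Submodule.span_le]
        rintro _ ⟨j, rfl⟩
        exact congrFun hX j
      obtain ⟨Y, rfl⟩ := exists_eq_mul_of_range_le h1
      exact ⟨Y, trivial, rfl⟩
    · rintro ⟨Y, -, rfl⟩
      refine funext fun j => ?_
      have h1 : D.mulVec (Y.col j) ∈ LinearMap.ker F :=
        hDF ▸ LinearMap.mem_range_self D.mulVecLin (Y.col j)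
      exact h1
  have hle : mulKerRed D ≤ (⊤ : AddSubgroup _).map (AddMonoidHom.mulLeft D) :=
    AddSubgroup.map_mono le_top
  rw [← AddSubgroup.relIndex_mul_index hle, mulKerRed,
    AddSubgroup.relIndex_map_map_of_injective _ _ hinj, AddSubgroup.relIndex_top_right,
    AddSubgroup.index_ker, ← hker, AddSubgroup.index_ker,
    AddMonoidHom.range_eq_top.2 (red_surjective n), AddMonoidHom.range_eq_top.2 hΦ]
  simp [Nat.card_fun]

theorem isOpen_mulKerRed {R H : Type*} [CommRing R] [IsDomain R] [IsDiscreteValuationRing R]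
    [AddCommGroup H] [Module R H] {n : ℕ} {D : Matrix (Fin n) (Fin n) R} {e : ℕ}
    (he : ∀ a ∈ maximalIdeal R ^ e, ∀ x : H, a • x = 0) {F : (Fin n → R) →ₗ[R] H}
    (hDF : LinearMap.range D.mulVecLin = LinearMap.ker F) :
    IsOpen (mulKerRed D : Set (Matrix (Fin n) (Fin n) R)) := by
  obtain ⟨ϖ, hϖ⟩ := IsDiscreteValuationRing.exists_irreducible R
  have hm := hϖ.maximalIdeal_eq
  -- The factor `ϖ^e` puts the columns in `ker F = im D`; the extra power makes the cofactor `ϖ • Y`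
  -- vanish under reduction.
  refine isOpen_addSubgroup_of_pow_le _ (e + 1) fun X hX => ?_
  have h1 : ∀ i j, ∃ c, X i j = ϖ * (ϖ ^ e * c) := fun i j => by
    have := hX i j
    rw [hm, Ideal.span_singleton_pow, Ideal.mem_span_singleton] at this
    obtain ⟨c, hc⟩ := this
    exact ⟨c, by rw [hc]; ring⟩
  choose c hc using h1
  have h2 : LinearMap.range (Matrix.of fun i j => ϖ ^ e * c i j).mulVecLin ≤
      LinearMap.range D.mulVecLin := by
    rw [hDF, Matrix.range_mulVecLin, Submodule.span_le]
    rintro _ ⟨j, rfl⟩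
    have h3 : (Matrix.of fun i j => ϖ ^ e * c i j).col j = ϖ ^ e • fun i => c i j := rfl
    rw [SetLike.mem_coe, LinearMap.mem_ker, h3, map_smul]
    exact he _ (Ideal.pow_mem_pow ((mem_maximalIdeal _).2 hϖ.1) e) _
  obtain ⟨Y, hY⟩ := exists_eq_mul_of_range_le h2
  refine ⟨ϖ • Y, ?_, ?_⟩
  · refine Matrix.ext fun i j => ?_
    change residue R (ϖ * Y i j) = 0
    rw [map_mul, (residue_eq_zero_iff ϖ).2 ((mem_maximalIdeal _).2 hϖ.1), zero_mul]
  · change D * (ϖ • Y) = X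
    rw [Matrix.mul_smul, ← hY]
    exact Matrix.ext fun i j => (hc i j).symm

/-- The set of the matrices `c + D Y` where the reduction of `Y` lies in `S`. -/
def affineSet {R : Type*} [CommRing R] [IsLocalRing R] {n : ℕ} (c D : Matrix (Fin n) (Fin n) R)
    (S : Set (Matrix (Fin n) (Fin n) (ResidueField R))) : Set (Matrix (Fin n) (Fin n) R) :=
  {A | ∃ Y, A = c + D * Y ∧ red n Y ∈ S}

/-- The set is a union of translates of `mulKerRed D`, one for each element of `S`. They are
disjoint because `D Y` determines `Y`, and by invariance each has measure the inverse of the index.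
-/
theorem measure_affineSet [Finite H] (c : Matrix (Fin n) (Fin n) R)
    {D : Matrix (Fin n) (Fin n) R} (hD : Function.Injective D.mulVec) {e : ℕ}
    (he : ∀ a ∈ maximalIdeal R ^ e, ∀ x : H, a • x = 0)
    {F : (Fin n → R) →ₗ[R] H} (hF : Function.Surjective F)
    (hDF : LinearMap.range D.mulVecLin = LinearMap.ker F)
    (S : Set (Matrix (Fin n) (Fin n) (ResidueField R))) :
    MeasurableSet (affineSet c D S) ∧
      (matHaar R n).real (affineSet c D S) = Nat.card S /
        (Nat.card (Matrix (Fin n) (Fin n) (ResidueField R)) * (Nat.card H : ℝ) ^ n) := by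
  have := mat_borelSpace R n
  have := mat_isTopologicalAddGroup R n
  have := isAddLeftInvariant_matHaar (R := R) n
  have := measurableAdd_mat (R := R) n
  have : MeasurableAdd (Matrix (Fin n) (Fin n) R) :=
    ⟨fun c => (continuous_const_add c).measurable, fun c => (continuous_add_const c).measurable⟩
  have := Fintype.ofFinite S
  choose t ht using red_surjective (R := R) n
  have hinj := mulLeft_injective hD
  have hU := (isOpen_mulKerRed he hDF).measurableSet
  have hmeas : ∀ s, MeasurableSet
      ((c + D * t s) +ᵥ (mulKerRed D : Set (Matrix (Fin n) (Fin n) R))) :=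
    fun s => hU.const_vadd _
  have hmem : ∀ s A, A ∈ (c + D * t s) +ᵥ (mulKerRed D : Set (Matrix (Fin n) (Fin n) R)) ↔
      ∃ Y, A = c + D * Y ∧ red n Y = s := by
    intro s A
    rw [Set.mem_vadd_set]
    constructor
    · rintro ⟨_, ⟨Z, hZ, rfl⟩, rfl⟩
      refine ⟨t s + Z, ?_, ?_⟩
      · change c + D * t s + D * Z = _
        rw [mul_add, add_assoc]
      · rw [map_add, ht, show red n Z = 0 from hZ, add_zero]
    · rintro ⟨Y, rfl, rfl⟩
      refine ⟨D * (Y - t (red n Y)), ⟨Y - t (red n Y), ?_, rfl⟩, ?_⟩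
      · change red n (Y - t (red n Y)) = 0
        rw [map_sub, ht, sub_self]
      · rw [vadd_eq_add, add_assoc, ← mul_add, add_sub_cancel]
  have hset : affineSet c D S =
      ⋃ s : S, (c + D * t s.1) +ᵥ (mulKerRed D : Set (Matrix (Fin n) (Fin n) R)) := by
    ext A
    simp only [Set.mem_iUnion, hmem]
    constructor
    · rintro ⟨Y, h1, h2⟩
      exact ⟨⟨_, h2⟩, Y, h1, rfl⟩
    · rintro ⟨s, Y, h1, h2⟩
      exact ⟨Y, h1, h2 ▸ s.2⟩
  have hdisj : Pairwise (Function.onFun Disjoint fun s : S =>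
      (c + D * t s.1) +ᵥ (mulKerRed D : Set (Matrix (Fin n) (Fin n) R))) := by
    intro s s' hss
    refine Set.disjoint_left.2 fun A h1 h2 => hss (Subtype.ext ?_)
    obtain ⟨Y, hY, hs⟩ := (hmem _ _).1 h1
    obtain ⟨Y', hY', hs'⟩ := (hmem _ _).1 h2
    have h3 : Y = Y' := hinj (add_left_cancel (hY.symm.trans hY'))
    rw [← hs, ← hs', h3]
  have hindex := index_mulKerRed hD hF hDF
  have hpos : 0 < (mulKerRed D).index := hindex ▸ Nat.mul_pos Nat.card_pos
    (Nat.pow_pos Nat.card_pos)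
  have hfin : (mulKerRed D).FiniteIndex := ⟨hpos.ne'⟩
  have h1 := AddSubgroup.index_mul_measure (mulKerRed D) hU (matHaar R n)
  have h2 : ((mulKerRed D).index : ℝ) * (matHaar R n).real (mulKerRed D) = 1 := by
    have := congrArg ENNReal.toReal h1
    simpa [matHaar_univ, Measure.real] using this
  refine ⟨hset ▸ MeasurableSet.iUnion fun s => hmeas _, ?_⟩
  rw [hset, measureReal_iUnion_fintype hdisj fun s => hmeas _]
  have h3 : ∀ s : S, (matHaar R n).real
      ((c + D * t s.1) +ᵥ (mulKerRed D : Set (Matrix (Fin n) (Fin n) R))) =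
        (matHaar R n).real (mulKerRed D) := fun s => by
    rw [Measure.real, measure_vadd]; rfl
  rw [Finset.sum_congr rfl fun s _ => h3 s, Finset.sum_const, Finset.card_univ,
    ← Nat.card_eq_fintype_card, nsmul_eq_mul, eq_div_iff (by exact_mod_cast hindex ▸ hpos.ne')]
  have h4 : ((mulKerRed D).index : ℝ) =
      Nat.card (Matrix (Fin n) (Fin n) (ResidueField R)) * (Nat.card H : ℝ) ^ n := by
    rw [hindex]; push_cast; rfl
  rw [← h4, mul_assoc, mul_comm _ ((mulKerRed D).index : ℝ), h2, mul_one]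

end Measure

/-! ### The exact probability for each `n` -/

section Probability

variable {R : Type*} [CommRing R] [IsDomain R] [IsDiscreteValuationRing R]
  [IsAdicComplete (maximalIdeal R) R] [Finite (ResidueField R)]

theorem measure_isUnit (n : ℕ) :
    MeasurableSet {A : Matrix (Fin n) (Fin n) R | IsUnit A} ∧
      (matHaar R n).real {A | IsUnit A} =
        (Nat.card {y : Matrix (Fin n) (Fin n) (ResidueField R) // IsUnit y} : ℝ) /
          Nat.card (Matrix (Fin n) (Fin n) (ResidueField R)) := by
  have hset : {A : Matrix (Fin n) (Fin n) R | IsUnit A} = affineSet 0 1 {y | IsUnit y} := by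
    ext A
    simp only [affineSet, zero_add, one_mul, Set.mem_ofPred_eq]
    exact ⟨fun h => ⟨A, rfl, isUnit_red_iff.2 h⟩, fun ⟨Y, h1, h2⟩ => h1 ▸ isUnit_red_iff.1 h2⟩
  have h1 : Function.Injective (1 : Matrix (Fin n) (Fin n) R).mulVec := fun x y h => by
    simpa using h
  -- The trivial module, presented by `D = 1`, makes the invertible matrices an affine set.
  have h2 := measure_affineSet (H := PUnit.{1}) (0 : Matrix (Fin n) (Fin n) R) h1 (e := 0)
    (fun _ _ _ => Subsingleton.elim _ _) (F := 0) (fun _ => ⟨0, Subsingleton.elim _ _⟩)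
    (by rw [LinearMap.ker_zero, Matrix.mulVecLin_one, LinearMap.range_id]) {y | IsUnit y}
  rw [hset]
  rw [Nat.card_unique (α := PUnit.{1}), Nat.cast_one, one_pow, mul_one] at h2
  exact h2

variable {H : Type*} [AddCommGroup H] [Module R H]

theorem measure_range_eq_ker [Finite H] {e : ℕ}
    (he : ∀ a ∈ maximalIdeal R ^ e, ∀ x : H, a • x = 0) {n : ℕ}
    {F : (Fin n → R) →ₗ[R] H} (hF : Function.Surjective F) :
    MeasurableSet {A : Matrix (Fin n) (Fin n) R |
        LinearMap.ker F = LinearMap.range (A - 1).mulVecLin ∧ IsUnit A} ∧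
      (matHaar R n).real {A | LinearMap.ker F = LinearMap.range (A - 1).mulVecLin ∧ IsUnit A} =
        (Nat.card {y : Matrix (Fin n) (Fin n) (ResidueField R) // IsUnit y} *
          ∑ k ∈ Finset.range (n + 1), (-1) ^ k / qFactorial (Nat.card (ResidueField R)) k *
            indepRatio (Nat.card (ResidueField R))
              (Nat.card (H ⧸ (maximalIdeal R • ⊤ : Submodule R H))) n k) /
          (Nat.card (Matrix (Fin n) (Fin n) (ResidueField R)) * (Nat.card H : ℝ) ^ n) := by
  obtain ⟨D, hD, hDF⟩ := exists_matrix_range_eq_ker he F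
  have hset : {A : Matrix (Fin n) (Fin n) R |
      LinearMap.ker F = LinearMap.range (A - 1).mulVecLin ∧ IsUnit A} =
        affineSet 1 D {y | IsUnit y ∧ IsUnit (1 + red n D * y)} := by
    ext A
    have h1 := range_eq_and_isUnit_iff (X := A - 1) hD
    rw [add_sub_cancel, hDF, eq_comm] at h1
    simp only [Set.mem_ofPred_eq, affineSet, h1, sub_eq_iff_eq_add']
  rw [hset, ← card_ker_red hF hDF, ← card_isUnit_and_isUnit]
  exact measure_affineSet 1 hD he hF hDF _

theorem probGL_eq [Finite H] {e : ℕ}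
    (he : ∀ a ∈ maximalIdeal R ^ e, ∀ x : H, a • x = 0) (n : ℕ) :
    probGL R n (fun A => Nonempty (Coker (A - 1) ≃ₗ[R] H)) =
      (Nat.card (H ≃ₗ[R] H) : ℝ)⁻¹ *
        ((Nat.card {F : (Fin n → R) →ₗ[R] H // Function.Surjective F} : ℝ) /
            (Nat.card H : ℝ) ^ n *
          ∑ k ∈ Finset.range (n + 1), (-1) ^ k / qFactorial (Nat.card (ResidueField R)) k *
            indepRatio (Nat.card (ResidueField R))
              (Nat.card (H ⧸ (maximalIdeal R • ⊤ : Submodule R H))) n k) := by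
  classical
  set b := ∑ k ∈ Finset.range (n + 1), (-1) ^ k / qFactorial (Nat.card (ResidueField R)) k *
    indepRatio (Nat.card (ResidueField R))
      (Nat.card (H ⧸ (maximalIdeal R • ⊤ : Submodule R H))) n k with hb
  have : Finite (H ≃ₗ[R] H) := Finite.of_injective _ DFunLike.coe_injective
  have := Fintype.ofFinite {F : (Fin n → R) →ₗ[R] H // Function.Surjective F}
  let T : {F : (Fin n → R) →ₗ[R] H // Function.Surjective F} → Set (Matrix (Fin n) (Fin n) R) :=
    fun F => {A | LinearMap.ker F.1 = LinearMap.range (A - 1).mulVecLin ∧ IsUnit A}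
  let E : Set (Matrix (Fin n) (Fin n) R) :=
    {A | IsUnit A} ∩ {A | Nonempty (Coker (A - 1) ≃ₗ[R] H)}
  have hT := fun F : {F : (Fin n → R) →ₗ[R] H // Function.Surjective F} =>
    measure_range_eq_ker he F.2
  obtain ⟨hGm, hG⟩ := measure_isUnit (R := R) n
  have hAut : (Nat.card (H ≃ₗ[R] H) : ℝ) ≠ 0 := by exact_mod_cast Nat.card_pos.ne'
  -- Pointwise double counting: an invertible `A` lies in `T F` for `|Aut H|` surjections `F` if its
  -- cokernel is `H`, and for none otherwise.
  have hcount : ∀ A, ∑ F, (T F).indicator (fun _ => (1 : ℝ)) A =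
      Nat.card (H ≃ₗ[R] H) * E.indicator (fun _ => (1 : ℝ)) A := by
    intro A
    by_cases hA : IsUnit A
    · have h1 := card_surjective_ker_eq (H := H) (A - 1)
      simp only [Set.indicator_apply, T, E, Set.mem_inter_iff, Set.mem_ofPred_eq, hA, and_true,
        true_and, Finset.sum_boole]
      rw [Nat.card_eq_fintype_card, Fintype.card_subtype] at h1
      rw [h1]
      split_ifs <;> simp
    · simp [T, E, hA]
  have hEm : MeasurableSet E := by
    -- Measurability of `E` is inherited from the sets `T F`: since `|Aut H| ≠ 0`, `E` is where the
    -- finite sum of their indicators does not vanish.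
    have h1 : E = (fun A => ∑ F, (T F).indicator (fun _ => (1 : ℝ)) A) ⁻¹' {0}ᶜ := by
      ext A
      simp only [Set.mem_preimage, hcount, Set.mem_compl_iff, Set.mem_singleton_iff, mul_eq_zero,
        hAut, false_or, Set.indicator_apply_eq_zero]
      simp
    rw [h1]
    exact (Finset.measurable_fun_sum _ fun F _ => measurable_const.indicator (hT F).1)
      (measurableSet_singleton _).compl
  have hE : Nat.card (H ≃ₗ[R] H) * (matHaar R n).real E =
      ∑ F, (matHaar R n).real (T F) := by
    have h1 : ∀ F, (matHaar R n).real (T F) =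
        ∫ A, (T F).indicator (fun _ => (1 : ℝ)) A ∂matHaar R n := fun F => by
      rw [integral_indicator_const _ (hT F).1, smul_eq_mul, mul_one]
    have h2 : (matHaar R n).real E = ∫ A, E.indicator (fun _ => (1 : ℝ)) A ∂matHaar R n := by
      rw [integral_indicator_const _ hEm, smul_eq_mul, mul_one]
    simp_rw [h1]
    rw [h2, ← integral_const_mul, ← integral_finsetSum _ fun F _ =>
      (integrable_const (1 : ℝ)).indicator (hT F).1]
    exact integral_congr_ae (Eventually.of_forall fun A => (hcount A).symm)
  have hprob : probGL R n (fun A => Nonempty (Coker (A - 1) ≃ₗ[R] H)) =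
      ((matHaar R n).real {A | IsUnit A})⁻¹ * (matHaar R n).real E := by
    rw [probGL, glHaar, Measure.real, ProbabilityTheory.cond_apply hGm, ENNReal.toReal_mul,
      ENNReal.toReal_inv]
    rfl
  have hM : (Nat.card (Matrix (Fin n) (Fin n) (ResidueField R)) : ℝ) ≠ 0 := by
    exact_mod_cast Nat.card_pos.ne'
  have hH : (Nat.card H : ℝ) ≠ 0 := by exact_mod_cast Nat.card_pos.ne'
  have hU : (Nat.card {y : Matrix (Fin n) (Fin n) (ResidueField R) // IsUnit y} : ℝ) ≠ 0 := by
    have : Nonempty {y : Matrix (Fin n) (Fin n) (ResidueField R) // IsUnit y} :=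
      ⟨⟨1, isUnit_one⟩⟩
    exact_mod_cast Nat.card_pos.ne'
  have hE' : (matHaar R n).real E = (Nat.card (H ≃ₗ[R] H) : ℝ)⁻¹ *
      ∑ F, (matHaar R n).real (T F) := by
    rw [← hE, inv_mul_cancel_left₀ hAut]
  rw [hprob, hE', hG, Finset.sum_congr rfl fun F _ => (hT F).2, Finset.sum_const,
    Finset.card_univ, ← Nat.card_eq_fintype_card, nsmul_eq_mul, ← hb]
  field_simp

end Probability

end HaarCokernel

theorem mainTheorem6 {R : Type*} [CommRing R] [IsDomain R] [IsDiscreteValuationRing R]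
    [IsAdicComplete (IsLocalRing.maximalIdeal R) R] [Finite (IsLocalRing.ResidueField R)]
    (q : ℕ) (hq : Nat.card (IsLocalRing.ResidueField R) = q)
    {H : Type*} [AddCommGroup H] [Module R H] (hH : IsFiniteLength R H) :
    Multipliable (fun i : ℕ => 1 - ((q : ℝ) ^ (i + 1))⁻¹) ∧
    Tendsto
      (fun n : ℕ => HaarCokernel.probGL R n
        (fun A => Nonempty (HaarCokernel.Coker (A - 1) ≃ₗ[R] H)))
      atTop
      (𝓝 ((Nat.card (H ≃ₗ[R] H) : ℝ)⁻¹ * ∏' i : ℕ, (1 - ((q : ℝ) ^ (i + 1))⁻¹))) := by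
  subst hq
  have hq : 1 < Nat.card (IsLocalRing.ResidueField R) := Finite.one_lt_card
  refine ⟨HaarCokernel.multipliable_one_sub_inv_pow (by exact_mod_cast hq), ?_⟩
  obtain ⟨hfin, e, he⟩ := HaarCokernel.finite_of_isFiniteLength hH
  simp_rw [HaarCokernel.probGL_eq he]
  refine Tendsto.const_mul _ ?_
  have := Finite.of_surjective _ (Submodule.mkQ_surjective
    (IsLocalRing.maximalIdeal R • ⊤ : Submodule R H))
  have h1 := (HaarCokernel.tendsto_card_surjective_div (R := R) (H := H)).mul
    (HaarCokernel.tendsto_sum_indepRatio hq (h := Nat.card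
      (H ⧸ (IsLocalRing.maximalIdeal R • ⊤ : Submodule R H))) Nat.card_pos)
  rwa [one_mul] at h1
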